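/- Let $T$ be a finitely generated torsion-free abelian group. Let $f_1,\dots,f_k$ and $g_1,\dots,g_\ell$ be linear forms in $n$ variables with integer coefficients, $f_i(t)=\sum_{s=1}^n a_{i,s}t_s$ and $g_j(t)=\sum_{s=1}^n b_{j,s}t_s$, and let $\alpha_1,\dots,\alpha_k,\beta_1,\dots,\beta_\ell$ be positive real numbers. Let $S_i=\{s: a_{i,s}\neq 0\}$ and $T_j=\{s: b_{j,s}\ne 0\}$, so that $f_i$ and $g_j$ may be regarded as functions on $T^{S_i}$ and $T^{T_j}$, and assume that the sets $S_1,\dots,S_k$ are pairwise disjoint. For sets $A_1,\dots,A_n$ and $S\subseteq\{1,\dots,n\}$ write $A_S=\prod_{s\in S}A_s$. For finitely supported probability distributions $P_1,\dots,P_n$ on $T$ and $S\subseteq\{1,\dots,n\}$, let $\Pi(X_S)$ be the set of all joint distributions of $X_S=(X_s)_{s\in S}$ on $T^S$ such that $X_s$ has distribution $P_s$ for each $s\in S$, and let $H$ denote Shannon entropy. Then for every linear form $f$ with integer coefficients and with support $S$ the maximum of $H(f(X_S))$ over $\Pi(X_S)$ exists, and the following three statements are equivalent: (a) For all non-empty finite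 sets $A_1,\dots,A_n\subseteq T$, $$\prod_{i=1}^k |f_i(A_{S_i})|^{\alpha_i}\le\prod_{j=1}^\ell |g_j(A_{T_j})|^{\beta_j}.$$ (b) For every $m\in\mathbb N$ and all non-empty finite sets $\hat A_1,\dots,\hat A_n\subseteq T^m$, $$\prod_{i=1}^k |\hat f_i(\hat A_{S_i})|^{\alpha_i}\le\prod_{j=1}^\ell |\hat g_j(\hat A_{T_j})|^{\beta_j},$$ where $\hat f_i$ and $\hat g_j$ are the coordinate-wise extensions of $f_i$ and $g_j$ to maps $(T^m)^{S_i}\to T^m$ and $(T^m)^{T_j}\to T^m$. (c) For all probability distributions $P_1,\dots,P_n$ on $T$ with finite support, $$\sum_{i=1}^k\alpha_i\max_{\Pi(X_{S_i})}H(f_i(X_{S_i}))\le\sum_{j=1}^\ell\beta_j\max_{\Pi(X_{T_j})}H(g_j(X_{T_j})).$$ -/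

import Mathlib

namespace SumsetEntropy

/-- The index set of the nonzero coefficients of the integer linear form `∑ i, c i • t i`. -/
def supp {n : ℕ} (c : Fin n → ℤ) : Finset (Fin n) :=
  Finset.univ.filter fun i => c i ≠ 0

/-- The linear form with integer coefficients `c`, as a function of the variables in its
support: `(t i)_{i ∈ supp c} ↦ ∑ i ∈ supp c, c i • t i`. -/
def form {T : Type*} [AddCommGroup T] {n : ℕ} (c : Fin n → ℤ) (t : supp c → T) : T :=
  ∑ i : supp c, c i • t i

/-- The coordinate-wise extension of `F : T ^ ι → T` to a map `(T ^ m) ^ ι → T ^ m`. -/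
def coordExt {T ι : Type*} (m : ℕ) (F : (ι → T) → T) (x : ι → Fin m → T) : Fin m → T :=
  fun r => F fun i => x i r

open Classical in
/-- The image `F (A_S)` of the Cartesian product `A_S = ∏_{i ∈ S} A i` under `F`. -/
noncomputable def boxImage {n : ℕ} {G H : Type*} (S : Finset (Fin n)) (F : (S → G) → H)
    (A : Fin n → Finset G) : Finset H :=
  (Fintype.piFinset fun i : S => A i).image F

/-- Shannon entropy (in nats) of a finitely supported distribution; the terms
`- p y * log (p y)` vanish off the support. -/
noncomputable def entropy {G : Type*} (p : PMF G) : ℝ :=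
  ∑' y, Real.negMulLog (p y).toReal

/-- The joint distributions of `(X i)_{i ∈ S}` with marginals `P i`, `i ∈ S`. -/
def couplings {T : Type*} {n : ℕ} (S : Finset (Fin n)) (P : Fin n → PMF T) :
    Set (PMF (S → T)) :=
  {q | ∀ i : S, q.map (fun x => x i) = P i}

/-- The values `H(f(X_S))` over all couplings of the marginals `P i`, `i ∈ S`, where `f` is the
form with coefficients `c` and `S` is its support. -/
def couplingEntropies {T : Type*} [AddCommGroup T] {n : ℕ} (c : Fin n → ℤ)
    (P : Fin n → PMF T) : Set ℝ :=
  (fun q : PMF (supp c → T) => entropy (q.map (form c))) '' couplings (supp c) P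

/-- The maximum of `H(f(X_S))` over all couplings of the marginals `P i`, `i ∈ S`. -/
noncomputable def maxEntropy {T : Type*} [AddCommGroup T] {n : ℕ} (c : Fin n → ℤ)
    (P : Fin n → PMF T) : ℝ :=
  sSup (couplingEntropies c P)

end SumsetEntropy

namespace SumsetEntropy

section

open scoped Classical

/-! ### Freiman models in one copy of the group -/

/-! The cycle is (a) ⇒ (b) ⇒ (c) ⇒ (a).

(a) ⇒ (b): a generic homomorphism `T ^ m → T` is injective on a given finite set
(`exists_hom_injOn`) and commutes with integer forms, so it carries sets in `T ^ m` to sets in `T`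
without shrinking the left-hand images.

(b) ⇒ (c): as the `S_i` are disjoint, one joint law attains all the left-hand maxima
(`exists_joint`). Approximate it by sequences `x` of length `m` and let `A_s` be the set of
rearrangements of the `s`-th coordinate of `x`. Rearranging all coordinates together bounds the
left-hand images below by the type class of `f_i ∘ x`, of size `exp (m H + O(log m))`. A right-hand
image meets only polynomially many type classes, and the largest is realised by a coupling with the
same marginals (`exists_log_card_boxImage_permOrbit_le`). Taking logarithms, dividing by `m` and
using compactness gives (c).

(c) ⇒ (a): lift the uniform law on each `f_i(A_{S_i})` to the box, glue the lifts, and apply (c) to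
the marginals; right-hand entropies are at most the log-cardinalities of the images. -/

lemma exists_hom_ne_zero {T : Type*} [AddCommGroup T] [IsAddTorsionFree T] (m : ℕ)
    (D : Finset (Fin m → T)) (hD : ∀ x ∈ D, x ≠ 0) :
    ∃ φ : (Fin m → T) →+ T, ∀ x ∈ D, φ x ≠ 0 := by
  induction m with
  | zero => exact ⟨0, fun x hx => absurd (Subsingleton.elim x 0) (hD x hx)⟩
  | succ m ih =>
    obtain ⟨φ, hφ⟩ := ih ((D.image Fin.tail).filter (· ≠ 0)) (by simp)
    -- By torsion-freeness each `x` excludes at most one `N`, so only finitely many `N` are bad.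
    have hfin : (⋃ x ∈ D, {N : ℕ | φ (Fin.tail x) ≠ 0 ∧
        x 0 + N • φ (Fin.tail x) = 0}).Finite := by
      refine D.finite_toSet.biUnion fun x _ => Set.Subsingleton.finite ?_
      rintro a ⟨h0, ha⟩ b ⟨-, hb⟩
      have hab := add_left_cancel (ha.trans hb.symm)
      have h1 : ((a : ℤ) - b) • φ (Fin.tail x) = 0 := by
        rw [sub_smul, natCast_zsmul, natCast_zsmul, hab, sub_self]
      have h2 := (IsAddTorsionFree.zsmul_eq_zero_iff_left h0).1 h1
      omega
    obtain ⟨N, hN⟩ := hfin.infinite_compl.nonempty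
    refine ⟨{ toFun := fun x => x 0 + N • φ (Fin.tail x)
              map_zero' := ?_
              map_add' := ?_ }, ?_⟩
    · have : Fin.tail (0 : Fin (m + 1) → T) = 0 := rfl
      simp [this]
    · intro x y
      have : Fin.tail (x + y) = Fin.tail x + Fin.tail y := rfl
      simp only [this, map_add, smul_add, Pi.add_apply]
      abel
    · intro x hx
      change x 0 + N • φ (Fin.tail x) ≠ 0
      by_cases ht : Fin.tail x = 0
      · rw [ht, map_zero, smul_zero, add_zero]
        intro h0
        refine hD x hx (funext fun i => ?_)
        refine Fin.cases h0 (fun i => congrFun ht i) i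
      · intro h
        refine hN ?_
        simp only [Set.mem_iUnion]
        exact ⟨x, hx, hφ _ (by simpa [ht] using ⟨x, hx, rfl⟩), h⟩

/-- It suffices that `φ` kill no nonzero difference of two elements of `U`. -/
lemma exists_hom_injOn {T : Type*} [AddCommGroup T] [IsAddTorsionFree T] (m : ℕ)
    (U : Finset (Fin m → T)) : ∃ φ : (Fin m → T) →+ T, Set.InjOn φ U := by
  obtain ⟨φ, hφ⟩ := exists_hom_ne_zero m
    (((U ×ˢ U).image fun p => p.1 - p.2).filter (· ≠ 0)) (by simp)
  refine ⟨φ, fun x hx y hy h => ?_⟩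
  by_contra hne
  refine hφ (x - y) ?_ (by rw [map_sub, h, sub_self])
  simp only [Finset.mem_filter, Finset.mem_image, Finset.mem_product]
  exact ⟨⟨(x, y), ⟨hx, hy⟩, rfl⟩, sub_ne_zero.2 hne⟩

lemma mem_boxImage {n : ℕ} {G H : Type*} {S : Finset (Fin n)} {F : (S → G) → H}
    {A : Fin n → Finset G} {y : H} :
    y ∈ boxImage S F A ↔ ∃ t : S → G, (∀ i : S, t i ∈ A i) ∧ F t = y := by
  simp [boxImage]

lemma boxImage_nonempty {n : ℕ} {G H : Type*} (S : Finset (Fin n)) (F : (S → G) → H)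
    {A : Fin n → Finset G} (hA : ∀ s, (A s).Nonempty) : (boxImage S F A).Nonempty := by
  choose a ha using hA
  exact ⟨F fun i => a i, mem_boxImage.2 ⟨_, fun i => ha _, rfl⟩⟩

lemma boxImage_image_hom {T : Type*} [AddCommGroup T] {n m : ℕ} (c : Fin n → ℤ)
    (φ : (Fin m → T) →+ T) (A : Fin n → Finset (Fin m → T)) :
    boxImage (supp c) (form c) (fun s => (A s).image φ) =
      (boxImage (supp c) (coordExt m (form c)) A).image φ := by
  have key : ∀ x : supp c → Fin m → T,
      form c (fun i => φ (x i)) = φ (coordExt m (form c) x) := by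
    intro x
    have : coordExt m (form c) x = ∑ i : supp c, c i • x i := by
      funext r
      simp [coordExt, form]
    rw [this, map_sum]
    simp [form]
  ext y
  simp only [Finset.mem_image, mem_boxImage]
  constructor
  · rintro ⟨t, ht, rfl⟩
    choose x hx hxt using ht
    refine ⟨_, ⟨x, hx, rfl⟩, ?_⟩
    rw [← key]
    exact congrArg _ (funext hxt)
  · rintro ⟨_, ⟨x, hx, rfl⟩, rfl⟩
    exact ⟨fun i => φ (x i), fun i => ⟨x i, hx i, rfl⟩, key x⟩

lemma card_boxImage_hom_le {T : Type*} [AddCommGroup T] [IsAddTorsionFree T]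
    {n k l : ℕ} (f : Fin k → Fin n → ℤ) (g : Fin l → Fin n → ℤ)
    (α : Fin k → ℝ) (β : Fin l → ℝ) (hβ : ∀ j, 0 ≤ β j)
    (h : ∀ A : Fin n → Finset T, (∀ s, (A s).Nonempty) →
        ∏ i, ((boxImage (supp (f i)) (form (f i)) A).card : ℝ) ^ α i ≤
          ∏ j, ((boxImage (supp (g j)) (form (g j)) A).card : ℝ) ^ β j)
    (m : ℕ) (A : Fin n → Finset (Fin m → T)) (hA : ∀ s, (A s).Nonempty) :
    ∏ i, ((boxImage (supp (f i)) (coordExt m (form (f i))) A).card : ℝ) ^ α i ≤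
      ∏ j, ((boxImage (supp (g j)) (coordExt m (form (g j))) A).card : ℝ) ^ β j := by
  -- Injectivity is needed only on the left-hand images: on the right, `φ` can only shrink the
  -- images, which is harmless since `β j ≥ 0`.
  obtain ⟨φ, hφ⟩ := exists_hom_injOn m
    (Finset.univ.biUnion fun i => boxImage (supp (f i)) (coordExt m (form (f i))) A)
  have h1 := h (fun s => (A s).image φ) (fun s => (hA s).image φ)
  simp only [boxImage_image_hom] at h1
  calc _ = ∏ i, (((boxImage (supp (f i)) (coordExt m (form (f i))) A).image φ).card : ℝ) ^ α i := by
        refine Finset.prod_congr rfl fun i _ => ?_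
        rw [Finset.card_image_of_injOn (hφ.mono ?_)]
        intro x hx
        simp only [Finset.coe_biUnion, Set.mem_iUnion]
        exact ⟨i, Finset.mem_coe.2 (Finset.mem_univ i), hx⟩
    _ ≤ _ := h1
    _ ≤ _ := by
        refine Finset.prod_le_prod (fun j _ => by positivity) fun j _ => ?_
        exact Real.rpow_le_rpow (by positivity) (by exact_mod_cast Finset.card_image_le) (hβ j)

/-! ### Gluing couplings over disjoint blocks -/

/-- Resample the coordinates in `S` according to `q'`, independently of the others. -/
noncomputable def resample {ι T : Type*} (q : PMF (ι → T)) (S : Finset ι) (q' : PMF (S → T)) :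
    PMF (ι → T) :=
  q.bind fun x => q'.map fun y s => if h : s ∈ S then y ⟨s, h⟩ else x s

lemma resample_map_restrict {ι T : Type*} (q : PMF (ι → T)) (S : Finset ι) (q' : PMF (S → T)) :
    (resample q S q').map (fun x (i : S) => x i) = q' := by
  have : ∀ x : ι → T, (q'.map fun y s => if h : s ∈ S then y ⟨s, h⟩ else x s).map
      (fun x (i : S) => x i) = q' := by
    intro x
    rw [PMF.map_comp]
    convert PMF.map_id q' using 2
    funext y i
    simp
  simp only [resample, PMF.map_bind, this, PMF.bind_const]

lemma resample_map_eq {ι T X : Type*} (q : PMF (ι → T)) (S : Finset ι) (q' : PMF (S → T))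
    (r : (ι → T) → X) (hr : ∀ x x', (∀ s ∉ S, x s = x' s) → r x = r x') :
    (resample q S q').map r = q.map r := by
  have : ∀ x : ι → T, (q'.map fun y s => if h : s ∈ S then y ⟨s, h⟩ else x s).map r =
      PMF.pure (r x) := by
    intro x
    rw [PMF.map_comp, ← PMF.map_const q' (r x)]
    congr 1
    funext y
    exact hr _ _ fun s hs => by simp [hs]
  simp only [resample, PMF.map_bind, this]
  rfl

/-- Starting from `q₀`, resample one block at a time; disjointness keeps the blocks already treated
intact. The constraint sets `M s` cover both uses: a prescribed marginal, and a marginal supported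
in `A s`. -/
lemma exists_joint {ι κ T : Type*} [Fintype κ] (S : κ → Finset ι)
    (hS : Pairwise fun i i' => Disjoint (S i) (S i')) (M : ι → Set (PMF T))
    (q₀ : PMF (ι → T)) (hq₀ : ∀ s, q₀.map (fun x => x s) ∈ M s)
    (q : ∀ i, PMF (S i → T)) (hq : ∀ i (s : S i), (q i).map (fun x => x s) ∈ M s) :
    ∃ p : PMF (ι → T), (∀ i, p.map (fun x (s : S i) => x s) = q i) ∧
      ∀ s, p.map (fun x => x s) ∈ M s := by
  suffices H : ∀ I : Finset κ, ∃ p : PMF (ι → T),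
      (∀ i ∈ I, p.map (fun x (s : S i) => x s) = q i) ∧ ∀ s, p.map (fun x => x s) ∈ M s by
    obtain ⟨p, h1, h2⟩ := H Finset.univ
    exact ⟨p, fun i => h1 i (Finset.mem_univ i), h2⟩
  intro I
  induction I using Finset.induction_on with
  | empty => exact ⟨q₀, by simp, hq₀⟩
  | insert a I ha ih =>
    obtain ⟨p, h1, h2⟩ := ih
    refine ⟨resample p (S a) (q a), ?_, ?_⟩
    · intro i hi
      rcases Finset.mem_insert.1 hi with rfl | hi
      · exact resample_map_restrict p _ _
      · rw [resample_map_eq, h1 i hi]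
        intro x x' hx
        funext s
        refine hx s fun hsa => ?_
        have hne : i ≠ a := fun h => ha (h ▸ hi)
        exact Finset.disjoint_left.1 (hS hne) s.2 hsa
    · intro s
      by_cases hs : s ∈ S a
      · have := hq a ⟨s, hs⟩
        rw [← resample_map_restrict p (S a) (q a), PMF.map_comp] at this
        exact this
      · rw [resample_map_eq]
        · exact h2 s
        · exact fun x x' hx => hx s hs

lemma exists_coupling {ι T : Type*} [Fintype ι] [Nonempty T] (P : ι → PMF T) :
    ∃ p : PMF (ι → T), ∀ s, p.map (fun x => x s) = P s := by
  suffices H : ∀ I : Finset ι, ∃ p : PMF (ι → T), ∀ s ∈ I, p.map (fun x => x s) = P s by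
    obtain ⟨p, h⟩ := H Finset.univ
    exact ⟨p, fun s => h s (Finset.mem_univ s)⟩
  intro I
  induction I using Finset.induction_on with
  | empty => exact ⟨PMF.pure fun _ => Classical.arbitrary T, by simp⟩
  | insert a I ha ih =>
    obtain ⟨p, h⟩ := ih
    refine ⟨resample p {a} ((P a).map fun t _ => t), fun s hs => ?_⟩
    by_cases hsa : s = a
    · subst hsa
      have := congrArg (PMF.map fun y : ({s} : Finset ι) → T => y ⟨s, by simp⟩)
        (resample_map_restrict p {s} ((P s).map fun t _ => t))
      rw [PMF.map_comp, PMF.map_comp] at this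
      exact this.trans (PMF.map_id _)
    · rw [resample_map_eq]
      · exact h s ((Finset.mem_insert.1 hs).resolve_left hsa)
      · exact fun x x' hx => hx s (by simpa using hsa)

end

section

open scoped Classical Nat
open Finset

/-! ### Permutation orbits of finite sequences -/

/-- Number of occurrences of `y` in the sequence `z`. -/
noncomputable def occ {m : ℕ} {Y : Type*} (z : Fin m → Y) (y : Y) : ℕ :=
  (univ.filter fun r => z r = y).card

/-- All rearrangements of the sequence `z`. -/
noncomputable def permOrbit {m : ℕ} {Y : Type*} (z : Fin m → Y) : Finset (Fin m → Y) :=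
  univ.image fun σ : Equiv.Perm (Fin m) => z ∘ σ

lemma mem_permOrbit {m : ℕ} {Y : Type*} {z z' : Fin m → Y} :
    z' ∈ permOrbit z ↔ ∃ σ : Equiv.Perm (Fin m), z ∘ σ = z' := by
  simp [permOrbit]

lemma permOrbit_nonempty {m : ℕ} {Y : Type*} (z : Fin m → Y) : (permOrbit z).Nonempty :=
  ⟨z, mem_permOrbit.2 ⟨1, rfl⟩⟩

lemma occ_comp_perm {m : ℕ} {Y : Type*} (z : Fin m → Y) (σ : Equiv.Perm (Fin m)) (y : Y) :
    occ (z ∘ σ) y = occ z y := by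
  refine Finset.card_bij (fun r _ => σ r) (by simp) (by simp) fun r hr => ⟨σ.symm r, ?_, by simp⟩
  simpa using hr

/-- Fibres of equal size are in bijection, and the bijections assemble into a permutation. -/
lemma mem_permOrbit_of_occ_eq {m : ℕ} {Y : Type*} {z z' : Fin m → Y}
    (h : ∀ y, occ z' y = occ z y) : z' ∈ permOrbit z := by
  have e : ∀ y, Nonempty ({r // z' r = y} ≃ {r // z r = y}) := fun y =>
    Fintype.card_eq.1 (by
      rw [Fintype.card_subtype, Fintype.card_subtype]
      exact h y)
  exact mem_permOrbit.2 ⟨Equiv.ofFiberEquiv fun y => (e y).some,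
    funext fun r => Equiv.ofFiberEquiv_map (fun y => (e y).some) r⟩

lemma sum_occ {m : ℕ} {Y : Type*} (z : Fin m → Y) (U : Finset Y) (hU : ∀ r, z r ∈ U) :
    ∑ y ∈ U, occ z y = m := by
  have := Finset.card_eq_sum_card_fiberwise (s := univ) (f := z) (t := U) (fun r _ => hU r)
  simpa [occ] using this.symm

lemma occ_le {m : ℕ} {Y : Type*} (z : Fin m → Y) (y : Y) : occ z y ≤ m :=
  (Finset.card_le_univ _).trans_eq (Fintype.card_fin m)

lemma occ_eq_zero {m : ℕ} {Y : Type*} {z : Fin m → Y} {y : Y} (h : ∀ r, z r ≠ y) :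
    occ z y = 0 := by
  simp [occ, h]

/-- Orbit-stabilizer: the stabilizer permutes each fibre of `z` separately, so the orbit has
multinomial size. -/
lemma card_permOrbit_mul {m : ℕ} {Y : Type*} (z : Fin m → Y) (U : Finset Y)
    (hU : ∀ r, z r ∈ U) :
    (permOrbit z).card * ∏ y ∈ U, (occ z y)! = m ! := by
  have hstab : (univ.filter fun σ : Equiv.Perm (Fin m) => z ∘ σ = z).card =
      ∏ y ∈ U, (occ z y)! := by
    rw [← Fintype.card_subtype, DomMulAct.stabilizer_card']
    refine (Finset.prod_congr rfl fun y _ => ?_).trans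
      (Finset.prod_subset (fun y hy => ?_) fun y _ hy => ?_)
    · rw [Fintype.card_subtype, occ]
    · obtain ⟨r, -, rfl⟩ := Finset.mem_image.1 hy
      exact hU r
    · rw [occ_eq_zero, Nat.factorial_zero]
      exact fun r hr => hy (Finset.mem_image.2 ⟨r, Finset.mem_univ r, hr⟩)
  have h := Finset.card_eq_sum_card_fiberwise (s := (univ : Finset (Equiv.Perm (Fin m))))
    (f := fun σ : Equiv.Perm (Fin m) => z ∘ σ) (t := permOrbit z) (fun σ _ => mem_permOrbit.2 ⟨σ, rfl⟩)
  rw [Finset.sum_congr rfl (g := fun _ => ∏ y ∈ U, (occ z y)!), Finset.sum_const, smul_eq_mul,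
    Finset.card_univ, Fintype.card_perm, Fintype.card_fin] at h
  · exact h.symm
  · intro z' hz'
    obtain ⟨τ, rfl⟩ := mem_permOrbit.1 hz'
    rw [← hstab]
    -- The permutations sending `z` to `z ∘ τ` form a coset of the stabilizer.
    refine Finset.card_bij (fun σ _ => σ * τ⁻¹) ?_ (by simp) ?_
    · intro σ hσ
      simp only [mem_filter, mem_univ, true_and] at hσ ⊢
      funext r
      simpa using congrFun hσ (τ⁻¹ r)
    · intro σ hσ
      simp only [mem_filter, mem_univ, true_and] at hσ
      refine ⟨σ * τ, ?_, by simp⟩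
      simp only [mem_filter, mem_univ, true_and]
      funext r
      simpa using congrFun hσ (τ r)

/-! ### Entropy asymptotics for orbits -/

/-- The error in the leading-order Stirling approximation `log n! ≈ n log n - n`. -/
noncomputable def stirlingErr (n : ℕ) : ℝ := Real.log n ! - (n * Real.log n - n)

lemma stirlingErr_succ_sub (n : ℕ) (hn : 0 < n) :
    stirlingErr (n + 1) - stirlingErr n = 1 - n * (Real.log (n + 1) - Real.log n) := by
  have : Real.log ((n + 1)! : ℝ) = Real.log (n + 1) + Real.log n ! := by
    rw [Nat.factorial_succ]
    push_cast
    exact Real.log_mul (by positivity) (by positivity)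
  simp only [stirlingErr, this]
  push_cast
  ring

/-- From `n` to `n + 1 ≥ 2` the error grows by at least `0` and at most `1 / (n + 1) ≤ log (n + 1) -
log n`, so the bounds telescope from the value `1` at `n = 1`. -/
lemma stirlingErr_bounds (n : ℕ) :
    0 ≤ stirlingErr n ∧ stirlingErr n ≤ 1 + Real.log (n + 1) := by
  rcases Nat.eq_zero_or_pos n with rfl | hn
  · simp [stirlingErr]
  suffices h : 0 ≤ stirlingErr n ∧ stirlingErr n ≤ 1 + Real.log n from
    ⟨h.1, h.2.trans (by gcongr; linarith)⟩
  induction n, hn using Nat.le_induction with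
  | base => simp [stirlingErr]
  | succ n hn ih =>
    have hn0 : (0 : ℝ) < n := by exact_mod_cast hn
    have hs := stirlingErr_succ_sub n hn
    have hq : Real.log (n + 1) - Real.log n = Real.log ((n + 1) / n) :=
      (Real.log_div (by positivity) (by positivity)).symm
    have h1 : Real.log (n + 1) - Real.log n ≤ 1 / n := by
      rw [hq]
      refine (Real.log_le_sub_one_of_pos (by positivity)).trans (le_of_eq ?_)
      field_simp
      ring
    have h2 : 1 / ((n : ℝ) + 1) ≤ Real.log (n + 1) - Real.log n := by
      rw [hq]
      refine le_trans (le_of_eq ?_) (Real.one_sub_inv_le_log_of_pos (by positivity))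
      field_simp
      ring
    have h3 : n * (Real.log (n + 1) - Real.log n) ≤ 1 := by
      calc _ ≤ n * (1 / (n : ℝ)) := by gcongr
        _ = 1 := by field_simp
    have h4 : 1 - 1 / ((n : ℝ) + 1) ≤ n * (Real.log (n + 1) - Real.log n) := by
      calc _ = n * (1 / ((n : ℝ) + 1)) := by field_simp; ring
        _ ≤ _ := by gcongr
    push_cast
    exact ⟨by linarith, by linarith⟩

/-- Entropy of the empirical distribution of `z`, whose values lie in `U`. -/
noncomputable def empEntropy {m : ℕ} {Y : Type*} (z : Fin m → Y) (U : Finset Y) : ℝ :=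
  ∑ y ∈ U, Real.negMulLog (occ z y / m)

/-- In the logarithm of the multinomial coefficient the linear Stirling terms cancel, because the
occurrence counts sum to `m`. -/
lemma log_card_permOrbit {m : ℕ} {Y : Type*} (hm : 0 < m) (z : Fin m → Y) (U : Finset Y)
    (hU : ∀ r, z r ∈ U) :
    Real.log (permOrbit z).card =
      m * empEntropy z U + stirlingErr m - ∑ y ∈ U, stirlingErr (occ z y) := by
  have hm0 : (m : ℝ) ≠ 0 := by positivity
  have hfac : ∀ n : ℕ, Real.log (n ! : ℝ) = n * Real.log n - n + stirlingErr n := by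
    intro n
    simp [stirlingErr]
  have h : Real.log (permOrbit z).card + ∑ y ∈ U, Real.log ((occ z y)! : ℝ) =
      Real.log (m ! : ℝ) := by
    rw [← card_permOrbit_mul z U hU]
    push_cast
    rw [Real.log_mul (by simpa using (permOrbit_nonempty z).ne_empty)
      (Finset.prod_ne_zero_iff.2 fun y _ => by positivity),
      Real.log_prod (fun y _ => by positivity)]
  have hsum : ∑ y ∈ U, (occ z y : ℝ) = m := by exact_mod_cast sum_occ z U hU
  have hent : m * empEntropy z U =
      m * Real.log m - ∑ y ∈ U, (occ z y : ℝ) * Real.log (occ z y) := by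
    have : ∀ y ∈ U, m * Real.negMulLog (occ z y / m) =
        occ z y * Real.log m - occ z y * Real.log (occ z y) := by
      intro y _
      rcases Nat.eq_zero_or_pos (occ z y) with h0 | h0
      · simp [h0]
      · rw [Real.negMulLog, Real.log_div (by positivity) hm0]
        field_simp
        ring
    rw [empEntropy, Finset.mul_sum, Finset.sum_congr rfl this, Finset.sum_sub_distrib,
      ← Finset.sum_mul, hsum]
  simp only [hfac, Finset.sum_add_distrib, Finset.sum_sub_distrib, hsum] at h
  linarith

lemma log_card_permOrbit_le {m : ℕ} {Y : Type*} (hm : 0 < m) (z : Fin m → Y) (U : Finset Y)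
    (hU : ∀ r, z r ∈ U) :
    Real.log (permOrbit z).card ≤ m * empEntropy z U + (1 + Real.log (m + 1)) := by
  rw [log_card_permOrbit hm z U hU]
  have := Finset.sum_nonneg fun y (_ : y ∈ U) => (stirlingErr_bounds (occ z y)).1
  linarith [(stirlingErr_bounds m).2]

lemma le_log_card_permOrbit {m : ℕ} {Y : Type*} (hm : 0 < m) (z : Fin m → Y) (U : Finset Y)
    (hU : ∀ r, z r ∈ U) :
    m * empEntropy z U - U.card * (1 + Real.log (m + 1)) ≤ Real.log (permOrbit z).card := by
  rw [log_card_permOrbit hm z U hU]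
  have : ∑ y ∈ U, stirlingErr (occ z y) ≤ U.card * (1 + Real.log (m + 1)) := by
    rw [← nsmul_eq_mul]
    refine Finset.sum_le_card_nsmul _ _ _ fun y _ => (stirlingErr_bounds _).2.trans ?_
    have : occ z y ≤ m := occ_le z y
    gcongr
  linarith [(stirlingErr_bounds m).1]

/-- A nonempty set of sequences with values in `U` is dominated by a single orbit, up to the number
of possible empirical distributions. -/
lemma exists_card_le_permOrbit {m : ℕ} {Y : Type*} (U : Finset Y) (Z : Finset (Fin m → Y))
    (hZ : Z.Nonempty) (hU : ∀ z ∈ Z, ∀ r, z r ∈ U) :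
    ∃ z ∈ Z, Z.card ≤ (m + 1) ^ U.card * (permOrbit z).card := by
  obtain ⟨z, hz, hmax⟩ := Z.exists_max_image (fun z => (permOrbit z).card) hZ
  refine ⟨z, hz, ?_⟩
  -- At most `(m + 1) ^ U.card` count vectors occur, and sequences with the same counts lie in one
  -- orbit.
  let type : (Fin m → Y) → (U → Fin (m + 1)) := fun z y =>
    ⟨occ z y, Nat.lt_succ_of_le (occ_le z y)⟩
  have h := Finset.card_le_mul_card_image_of_maps_to (s := Z) (f := type) (t := univ)
    (fun _ _ => Finset.mem_univ _) (permOrbit z).card ?_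
  · simpa [mul_comm] using h
  intro τ _
  rcases (Z.filter fun z' => type z' = τ).eq_empty_or_nonempty with he | ⟨z₀, hz₀⟩
  · rw [he]; simp
  rw [mem_filter] at hz₀
  refine le_trans (Finset.card_le_card fun z' hz' => ?_) (hmax z₀ hz₀.1)
  rw [mem_filter] at hz'
  refine mem_permOrbit_of_occ_eq fun y => ?_
  by_cases hy : y ∈ U
  · have := congrFun (hz'.2.trans hz₀.2.symm) ⟨y, hy⟩
    exact congrArg Fin.val this
  · rw [occ_eq_zero fun r (hr : z' r = y) => hy (hr ▸ hU _ hz'.1 r),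
      occ_eq_zero fun r (hr : z₀ r = y) => hy (hr ▸ hU _ hz₀.1 r)]

end

section

open scoped Classical Topology
open Finset Filter

/-! ### Weights on finite types -/

/-- Push-forward of the weight `w` under `F`. -/
noncomputable def push {Ω Y : Type*} [Fintype Ω] (F : Ω → Y) (w : Ω → ℝ) (y : Y) : ℝ :=
  ∑ ω with F ω = y, w ω

/-- Entropy of the push-forward of the weight `w` under `F`. -/
noncomputable def pushEntropy {Ω Y : Type*} [Fintype Ω] (F : Ω → Y) (w : Ω → ℝ) : ℝ :=
  ∑ y ∈ univ.image F, Real.negMulLog (push F w y)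

lemma continuous_push {Ω Y : Type*} [Fintype Ω] (F : Ω → Y) (y : Y) :
    Continuous fun w : Ω → ℝ => push F w y :=
  continuous_finsetSum _ fun ω _ => continuous_apply ω

lemma continuous_pushEntropy {Ω Y : Type*} [Fintype Ω] (F : Ω → Y) :
    Continuous fun w : Ω → ℝ => pushEntropy F w :=
  continuous_finsetSum _ fun y _ => Real.continuous_negMulLog.comp (continuous_push F y)

/-- The weight of a distribution on a finite type. -/
noncomputable def weight {Ω : Type*} (p : PMF Ω) (ω : Ω) : ℝ := (p ω).toReal

lemma weight_mem {Ω : Type*} [Fintype Ω] (p : PMF Ω) : weight p ∈ stdSimplex ℝ Ω := by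
  refine ⟨fun ω => ENNReal.toReal_nonneg, ?_⟩
  have h := p.tsum_coe
  rw [tsum_fintype] at h
  simp only [weight]
  rw [← ENNReal.toReal_sum fun ω _ => p.apply_ne_top ω, h, ENNReal.toReal_one]

lemma exists_weight_eq {Ω : Type*} [Fintype Ω] {w : Ω → ℝ} (hw : w ∈ stdSimplex ℝ Ω) :
    ∃ p : PMF Ω, weight p = w := by
  refine ⟨PMF.ofFintype (fun ω => ENNReal.ofReal (w ω)) ?_, ?_⟩
  · rw [← ENNReal.ofReal_sum_of_nonneg fun ω _ => hw.1 ω, hw.2, ENNReal.ofReal_one]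
  · funext ω
    simp [weight, PMF.ofFintype_apply, ENNReal.toReal_ofReal (hw.1 ω)]

lemma toReal_map_apply {Ω Y : Type*} [Fintype Ω] (p : PMF Ω) (F : Ω → Y) (y : Y) :
    (p.map F y).toReal = push F (weight p) y := by
  rw [PMF.map_apply, tsum_fintype, ENNReal.toReal_sum]
  · simp only [push, weight, Finset.sum_filter]
    refine Finset.sum_congr rfl fun ω _ => ?_
    by_cases h : F ω = y
    · simp [h]
    · simp [h, Ne.symm h]
  · intro ω _
    split_ifs
    · exact p.apply_ne_top ω
    · simp

lemma entropy_map {Ω Y : Type*} [Fintype Ω] (p : PMF Ω) (F : Ω → Y) :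
    entropy (p.map F) = pushEntropy F (weight p) := by
  simp only [entropy, pushEntropy, toReal_map_apply]
  refine tsum_eq_sum fun y hy => ?_
  have : push F (weight p) y = 0 := by
    refine Finset.sum_eq_zero fun ω hω => absurd ?_ hy
    rw [Finset.mem_filter] at hω
    exact Finset.mem_image.2 ⟨ω, hω⟩
  simp [this]

lemma map_congr_support {X Y : Type*} (q : PMF X) {F G : X → Y}
    (h : ∀ x ∈ q.support, F x = G x) : q.map F = q.map G := by
  ext y
  simp only [PMF.map_apply]
  refine tsum_congr fun x => ?_
  by_cases hx : x ∈ q.support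
  · rw [h x hx]
  · rw [PMF.mem_support_iff, not_not] at hx
    simp [hx]

/-- Push `q` forward along a choice of preimages under `e`. -/
lemma exists_map_eq {Ω X : Type*} (q : PMF X) (e : Ω → X)
    (h : ∀ x ∈ q.support, x ∈ Set.range e) : ∃ p : PMF Ω, p.map e = q := by
  obtain ⟨x₀, hx₀⟩ := q.support_nonempty
  obtain ⟨ω₀, -⟩ := h x₀ hx₀
  have : Nonempty Ω := ⟨ω₀⟩
  refine ⟨q.map (Function.invFun e), ?_⟩
  rw [PMF.map_comp, map_congr_support q (G := id), PMF.map_id]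
  exact fun x hx => Function.invFun_eq (h x hx)

/-! ### Couplings as a compact set of weights -/

/-- Weights on `S → D` with marginals `P`. -/
def couplingWeights {T : Type*} {n : ℕ} (S : Finset (Fin n)) (P : Fin n → PMF T)
    (D : Finset T) : Set ((S → D) → ℝ) :=
  {w | w ∈ stdSimplex ℝ (S → D) ∧
    ∀ (s : S) (t : T), push (fun ω : S → D => (ω s : T)) w t = (P s t).toReal}

lemma isCompact_couplingWeights {T : Type*} {n : ℕ} (S : Finset (Fin n)) (P : Fin n → PMF T)
    (D : Finset T) : IsCompact (couplingWeights S P D) := by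
  refine (isCompact_stdSimplex ℝ (S → D)).inter_right (?_ : IsClosed {w : (S → D) → ℝ |
    ∀ (s : S) (t : T), push (fun ω : S → D => (ω s : T)) w t = (P s t).toReal})
  simp only [Set.ofPred_forall]
  exact isClosed_iInter fun s => isClosed_iInter fun t =>
    isClosed_eq (continuous_push _ t) continuous_const

lemma exists_map_val_eq {ι T : Type*} (D : Finset T) (q : PMF (ι → T))
    (hq : ∀ s, ∀ t ∈ (q.map fun x => x s).support, t ∈ D) :
    ∃ p : PMF (ι → D), p.map (fun ω s => (ω s : T)) = q := by
  refine exists_map_eq q _ fun x hx => ?_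
  have hx' : ∀ s, x s ∈ D := fun s =>
    hq s _ ((PMF.mem_support_map_iff _ _ _).2 ⟨x, hx, rfl⟩)
  exact ⟨fun s => ⟨x s, hx' s⟩, rfl⟩

lemma map_val_mem_couplings {T : Type*} {n : ℕ} {S : Finset (Fin n)} {P : Fin n → PMF T}
    {D : Finset T} (p : PMF (S → D)) :
    p.map (fun ω s => (ω s : T)) ∈ couplings S P ↔ weight p ∈ couplingWeights S P D := by
  have key : ∀ (s : S), ((p.map (fun ω s => (ω s : T))).map fun x => x s) = P s ↔
      ∀ t : T, push (fun ω : S → D => (ω s : T)) (weight p) t = (P s t).toReal := by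
    intro s
    rw [PMF.map_comp]
    simp only [← toReal_map_apply]
    constructor
    · intro h t
      rw [← h]
      rfl
    · intro h
      ext t
      exact (ENNReal.toReal_eq_toReal_iff' (PMF.apply_ne_top _ _) (PMF.apply_ne_top _ _)).1 (h t)
  exact ⟨fun h => ⟨weight_mem p, fun s => (key s).1 (h s)⟩, fun h s => (key s).2 (h.2 s)⟩

/-- Every coupling lives on the finite set `supp c → D`, so the attainable entropies are a
continuous image of a compact set of weights. -/
lemma couplingEntropies_eq {T : Type*} [AddCommGroup T] {n : ℕ} (c : Fin n → ℤ)
    (P : Fin n → PMF T) (D : Finset T) (hD : ∀ s, ∀ t ∈ (P s).support, t ∈ D) :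
    couplingEntropies c P =
      pushEntropy (fun ω : supp c → D => form c fun s => (ω s : T)) ''
        couplingWeights (supp c) P D := by
  ext h
  constructor
  · rintro ⟨q, hq, rfl⟩
    obtain ⟨p, rfl⟩ := exists_map_val_eq D q fun s t ht => hD s t (hq s ▸ ht)
    refine ⟨weight p, (map_val_mem_couplings p).1 hq, ?_⟩
    simp only [PMF.map_comp]
    exact (entropy_map p _).symm
  · rintro ⟨w, hw, rfl⟩
    obtain ⟨p, rfl⟩ := exists_weight_eq hw.1
    refine ⟨_, (map_val_mem_couplings p).2 hw, ?_⟩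
    simp only [PMF.map_comp]
    exact entropy_map p _

lemma exists_finset_support {T ι : Type*} [Fintype ι] (P : ι → PMF T)
    (hP : ∀ s, (P s).support.Finite) : ∃ D : Finset T, ∀ s, ∀ t ∈ (P s).support, t ∈ D := by
  refine ⟨univ.biUnion fun s => (hP s).toFinset, fun s t ht => ?_⟩
  simp only [Finset.mem_biUnion]
  exact ⟨s, Finset.mem_univ s, (hP s).mem_toFinset.2 ht⟩

lemma isGreatest_maxEntropy {T : Type*} [AddCommGroup T] {n : ℕ} (c : Fin n → ℤ)
    (P : Fin n → PMF T) (hP : ∀ s, (P s).support.Finite) :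
    IsGreatest (couplingEntropies c P) (maxEntropy c P) := by
  obtain ⟨D, hD⟩ := exists_finset_support P hP
  refine IsCompact.isGreatest_sSup ?_ ?_
  · rw [couplingEntropies_eq c P D hD]
    exact (isCompact_couplingWeights _ P D).image (continuous_pushEntropy _)
  · obtain ⟨q, hq⟩ := exists_coupling fun s : supp c => P s
    exact ⟨_, q, hq, rfl⟩

/-! ### Entropy bounds for distributions supported in a finite set -/

lemma entropy_le_log_card {Y : Type*} (p : PMF Y) (U : Finset Y) (hU : ∀ y ∈ p.support, y ∈ U) :
    entropy p ≤ Real.log U.card := by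
  have h0 : ∀ y ∉ U, p y = 0 := fun y hy => by
    by_contra h
    exact hy (hU y ((PMF.mem_support_iff _ _).2 h))
  have hsum : ∑ y ∈ U, (p y).toReal = 1 := by
    have h1 := p.tsum_coe
    rw [tsum_eq_sum (s := U) h0] at h1
    rw [← ENNReal.toReal_sum fun y _ => p.apply_ne_top y, h1, ENNReal.toReal_one]
  have hne : U.Nonempty := by
    by_contra h
    rw [Finset.not_nonempty_iff_eq_empty] at h
    simp [h] at hsum
  have hc : (0 : ℝ) < U.card := by exact_mod_cast hne.card_pos
  rw [entropy, tsum_eq_sum (s := U) fun y hy => by simp [h0 y hy]]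
  -- Jensen's inequality with equal weights on `U`.
  have hj := Real.concaveOn_negMulLog.le_map_sum (t := U) (w := fun _ => (U.card : ℝ)⁻¹)
    (p := fun y => (p y).toReal) (fun _ _ => by positivity)
    (by simp [hc.ne']) (fun y _ => Set.mem_Ici.2 ENNReal.toReal_nonneg)
  simp only [smul_eq_mul, ← Finset.mul_sum, hsum, mul_one] at hj
  rw [Real.negMulLog, Real.log_inv] at hj
  have := mul_le_mul_of_nonneg_left hj hc.le
  field_simp at this
  linarith

lemma entropy_uniform {Y : Type*} (U : Finset Y) (hU : U.Nonempty) :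
    entropy (PMF.uniformOfFinset U hU) = Real.log U.card := by
  have hc : (0 : ℝ) < U.card := by exact_mod_cast hU.card_pos
  rw [entropy, tsum_eq_sum (s := U) fun y hy => by simp [PMF.uniformOfFinset_apply_of_notMem _ hy]]
  rw [Finset.sum_congr rfl (g := fun _ => Real.negMulLog (U.card : ℝ)⁻¹)]
  · rw [Finset.sum_const, nsmul_eq_mul, Real.negMulLog, Real.log_inv]
    field_simp
  · intro y hy
    rw [PMF.uniformOfFinset_apply_of_mem _ hy]
    simp

lemma map_support_subset_boxImage {T : Type*} {n : ℕ} {S : Finset (Fin n)} (F : (S → T) → T)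
    {A : Fin n → Finset T} {q : PMF (S → T)}
    (hq : ∀ s : S, ∀ t ∈ (q.map fun x => x s).support, t ∈ A s) :
    ∀ y ∈ (q.map F).support, y ∈ boxImage S F A := by
  intro y hy
  obtain ⟨x, hx, rfl⟩ := (PMF.mem_support_map_iff _ _ _).1 hy
  exact mem_boxImage.2
    ⟨x, fun s => hq s _ ((PMF.mem_support_map_iff _ _ _).2 ⟨x, hx, rfl⟩), rfl⟩

lemma exists_uniform_boxImage {T : Type*} {n : ℕ} (S : Finset (Fin n)) (F : (S → T) → T)
    {A : Fin n → Finset T} (hA : ∀ s, (A s).Nonempty) :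
    ∃ q : PMF (S → T), (∀ s : S, ∀ t ∈ (q.map fun x => x s).support, t ∈ A s) ∧
      entropy (q.map F) = Real.log (boxImage S F A).card := by
  obtain ⟨q, hq⟩ := exists_map_eq
    (PMF.uniformOfFinset (boxImage S F A) (boxImage_nonempty S F hA))
    (fun ω : ∀ s : S, A s => F fun s => (ω s : T)) fun y hy => by
      rw [PMF.mem_support_uniformOfFinset_iff, mem_boxImage] at hy
      obtain ⟨t, ht, rfl⟩ := hy
      exact ⟨fun s => ⟨t s, ht s⟩, rfl⟩
  refine ⟨q.map fun ω s => (ω s : T), fun s t ht => ?_, ?_⟩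
  · rw [PMF.map_comp] at ht
    obtain ⟨ω, -, rfl⟩ := (PMF.mem_support_map_iff _ _ _).1 ht
    exact (ω s).2
  · rw [PMF.map_comp, ← entropy_uniform _ (boxImage_nonempty S F hA), ← hq]
    rfl

lemma prod_rpow_le_iff_sum_log_le {κ ι : Type*} [Fintype κ] [Fintype ι] (a : κ → ℕ) (b : ι → ℕ)
    (ha : ∀ i, 0 < a i) (hb : ∀ j, 0 < b j) (α : κ → ℝ) (β : ι → ℝ) :
    ∏ i, (a i : ℝ) ^ α i ≤ ∏ j, (b j : ℝ) ^ β j ↔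
      ∑ i, α i * Real.log (a i) ≤ ∑ j, β j * Real.log (b j) := by
  have ha' : ∀ i, (0 : ℝ) < a i := fun i => by exact_mod_cast ha i
  have hb' : ∀ j, (0 : ℝ) < b j := fun j => by exact_mod_cast hb j
  rw [← Real.log_le_log_iff (Finset.prod_pos fun i _ => Real.rpow_pos_of_pos (ha' i) _)
      (Finset.prod_pos fun j _ => Real.rpow_pos_of_pos (hb' j) _),
    Real.log_prod (fun i _ => (Real.rpow_pos_of_pos (ha' i) _).ne'),
    Real.log_prod (fun j _ => (Real.rpow_pos_of_pos (hb' j) _).ne')]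
  simp only [Real.log_rpow (ha' _), Real.log_rpow (hb' _)]

/-- This is (c) ⇒ (a). -/
lemma card_boxImage_le_of_maxEntropy_le {T : Type*} [AddCommGroup T]
    {n k l : ℕ} (f : Fin k → Fin n → ℤ) (g : Fin l → Fin n → ℤ)
    (α : Fin k → ℝ) (β : Fin l → ℝ) (hα : ∀ i, 0 ≤ α i) (hβ : ∀ j, 0 ≤ β j)
    (hf : Pairwise fun i i' => Disjoint (supp (f i)) (supp (f i')))
    (h : ∀ P : Fin n → PMF T, (∀ s, (P s).support.Finite) →
        ∑ i, α i * maxEntropy (f i) P ≤ ∑ j, β j * maxEntropy (g j) P)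
    (A : Fin n → Finset T) (hA : ∀ s, (A s).Nonempty) :
    ∏ i, ((boxImage (supp (f i)) (form (f i)) A).card : ℝ) ^ α i ≤
      ∏ j, ((boxImage (supp (g j)) (form (g j)) A).card : ℝ) ^ β j := by
  rw [prod_rpow_le_iff_sum_log_le _ _ (fun i => (boxImage_nonempty _ _ hA).card_pos)
    (fun j => (boxImage_nonempty _ _ hA).card_pos)]
  choose q hqA hqe using fun i => exists_uniform_boxImage (supp (f i)) (form (f i)) hA
  choose a ha using hA
  -- The point mass at `a` serves the coordinates outside every block; there only support in `A s`
  -- matters.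
  obtain ⟨p, hpq, hpA⟩ := exists_joint (fun i => supp (f i)) hf
    (fun s => {P : PMF T | ∀ t ∈ P.support, t ∈ A s}) (PMF.pure a)
    (fun s t ht => by
      rw [PMF.pure_map, PMF.mem_support_pure_iff] at ht
      exact ht ▸ ha s) q (fun i s => hqA i s)
  have hfin : ∀ s, (p.map fun x => x s).support.Finite := fun s =>
    (A s).finite_toSet.subset (hpA s)
  refine le_trans (Finset.sum_le_sum fun i _ => ?_) ((h _ hfin).trans
    (Finset.sum_le_sum fun j _ => ?_))
  · refine mul_le_mul_of_nonneg_left ?_ (hα i)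
    rw [← hqe i]
    refine (isGreatest_maxEntropy (f i) _ hfin).2 ⟨q i, fun s => ?_, rfl⟩
    rw [← hpq i, PMF.map_comp]
    rfl
  · refine mul_le_mul_of_nonneg_left ?_ (hβ j)
    obtain ⟨r, hr, hre⟩ := (isGreatest_maxEntropy (g j) _ hfin).1
    rw [← hre]
    exact entropy_le_log_card _ _ (map_support_subset_boxImage _ fun s t ht => by
      rw [hr s] at ht
      exact hpA s t ht)

end

section

open scoped Classical Topology
open Finset Filter

/-! ### Empirical distributions -/

/-- Empirical distribution of the sequence `z`. -/
noncomputable def emp {m : ℕ} {Y : Type*} (z : Fin m → Y) (y : Y) : ℝ := occ z y / m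

lemma push_emp {m : ℕ} {Ω Y : Type*} [Fintype Ω] (F : Ω → Y) (z : Fin m → Ω) (y : Y) :
    push F (emp z) y = emp (F ∘ z) y := by
  simp only [push, emp, ← Finset.sum_div]
  congr 1
  have := Finset.card_eq_sum_card_fiberwise (s := univ.filter fun r => F (z r) = y) (f := z)
    (t := univ.filter fun ω => F ω = y) (fun r hr => by simpa using hr)
  simp only [occ, Function.comp_apply]
  rw [this]
  push_cast
  refine Finset.sum_congr rfl fun ω hω => ?_
  rw [Finset.mem_filter] at hω
  congr 2
  ext r
  simp only [mem_filter, mem_univ, true_and]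
  exact ⟨fun h => ⟨h ▸ hω.2, h⟩, fun h => h.2⟩

lemma pushEntropy_emp {m : ℕ} {Ω Y : Type*} [Fintype Ω] (F : Ω → Y) (z : Fin m → Ω) :
    pushEntropy F (emp z) = empEntropy (F ∘ z) (univ.image F) := by
  simp only [pushEntropy, empEntropy, push_emp]
  rfl

lemma emp_mem {m : ℕ} (hm : 0 < m) {Ω : Type*} [Fintype Ω] (z : Fin m → Ω) :
    emp z ∈ stdSimplex ℝ Ω := by
  refine ⟨fun ω => by unfold emp; positivity, ?_⟩
  have : ∑ ω, (occ z ω : ℝ) = m := by exact_mod_cast sum_occ z univ fun r => Finset.mem_univ _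
  simp only [emp, ← Finset.sum_div, this]
  exact div_self (by positivity)

/-- List each `ω` exactly `κ ω` times. -/
lemma exists_occ_eq {m : ℕ} {Ω : Type*} [Fintype Ω] (κ : Ω → ℕ) (hκ : ∑ ω, κ ω = m) :
    ∃ z : Fin m → Ω, ∀ ω, occ z ω = κ ω := by
  have e : Fin m ≃ Σ ω, Fin (κ ω) := Fintype.equivOfCardEq (by simp [hκ])
  refine ⟨fun r => (e r).1, fun ω => ?_⟩
  rw [occ, ← Fintype.card_subtype,
    Fintype.card_congr (e.subtypeEquiv (q := fun p : Σ ω, Fin (κ ω) => p.1 = ω) fun _ => Iff.rfl),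
    Fintype.card_congr (Equiv.sigmaSubtype ω), Fintype.card_fin]

lemma exists_emp_tendsto {Ω : Type*} [Fintype Ω] {q : Ω → ℝ} (hq : q ∈ stdSimplex ℝ Ω) :
    ∃ z : ∀ m : ℕ, Fin m → Ω, Tendsto (fun m => emp (z m)) atTop (𝓝 q) := by
  have hne : Nonempty Ω := by
    by_contra h
    rw [not_nonempty_iff] at h
    simpa using hq.2
  obtain ⟨ω₀⟩ := hne
  have hfl : ∀ m : ℕ, ∑ ω, ⌊m * q ω⌋₊ ≤ m := fun m => by
    have : ∑ ω, (⌊m * q ω⌋₊ : ℝ) ≤ ∑ ω, m * q ω :=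
      Finset.sum_le_sum fun ω _ => Nat.floor_le (mul_nonneg m.cast_nonneg (hq.1 ω))
    rw [← Finset.mul_sum, hq.2, mul_one] at this
    exact_mod_cast this
  have hfl' : ∀ m : ℕ, (m : ℝ) - Fintype.card Ω ≤ ∑ ω, (⌊m * q ω⌋₊ : ℝ) := fun m => by
    have : ∑ ω, (m * q ω - 1) ≤ ∑ ω, (⌊m * q ω⌋₊ : ℝ) :=
      Finset.sum_le_sum fun ω _ => (Nat.sub_one_lt_floor _).le
    rw [Finset.sum_sub_distrib, ← Finset.mul_sum, hq.2] at this
    simpa using this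
  -- Round `m * q ω` down and give the deficit, at most `Fintype.card Ω`, to `ω₀`; each frequency is
  -- then within `O(1 / m)` of `q ω`.
  let κ : ℕ → Ω → ℕ := fun m ω =>
    ⌊m * q ω⌋₊ + if ω = ω₀ then m - ∑ ω, ⌊m * q ω⌋₊ else 0
  have hκ : ∀ m, ∑ ω, κ m ω = m := fun m => by
    simp only [κ, Finset.sum_add_distrib, Finset.sum_ite_eq', Finset.mem_univ, if_true]
    have := hfl m
    omega
  choose z hz using fun m => exists_occ_eq (κ m) (hκ m)
  refine ⟨z, tendsto_pi_nhds.2 fun ω => ?_⟩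
  have hlim : ∀ C : ℝ, Tendsto (fun m : ℕ => q ω + C / m) atTop (𝓝 (q ω)) := fun C => by
    simpa using (tendsto_const_div_atTop_nhds_zero_nat C).const_add (q ω)
  refine tendsto_of_tendsto_of_tendsto_of_le_of_le' (hlim (-1)) (hlim (Fintype.card Ω)) ?_ ?_
  all_goals
    filter_upwards [eventually_gt_atTop 0] with m hm
    have hm0 : (0 : ℝ) < m := by exact_mod_cast hm
    simp only [emp, hz, κ]
    rw [← sub_nonneg]
  · have h1 : m * q ω - 1 ≤ (⌊m * q ω⌋₊ : ℝ) := (Nat.sub_one_lt_floor _).le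
    have h2 : (0 : ℝ) ≤ (if ω = ω₀ then m - ∑ ω, ⌊m * q ω⌋₊ else 0 : ℕ) := Nat.cast_nonneg _
    have : 0 ≤ ((⌊m * q ω⌋₊ : ℝ) + (if ω = ω₀ then m - ∑ ω, ⌊m * q ω⌋₊ else 0 : ℕ)
        - (m * q ω - 1)) / m := div_nonneg (by linarith) hm0.le
    refine this.trans_eq ?_
    push_cast
    field_simp
    ring
  · have h1 : (⌊m * q ω⌋₊ : ℝ) ≤ m * q ω := Nat.floor_le (mul_nonneg hm0.le (hq.1 ω))
    have h2 : ((if ω = ω₀ then m - ∑ ω, ⌊m * q ω⌋₊ else 0 : ℕ) : ℝ) ≤ Fintype.card Ω := by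
      split_ifs
      · rw [Nat.cast_sub (hfl m)]
        push_cast
        linarith [hfl' m]
      · simp
    have : 0 ≤ (m * q ω + Fintype.card Ω - ((⌊m * q ω⌋₊ : ℝ) +
        (if ω = ω₀ then m - ∑ ω, ⌊m * q ω⌋₊ else 0 : ℕ))) / m := div_nonneg (by linarith) hm0.le
    refine this.trans_eq ?_
    push_cast
    field_simp

/-! ### Bounds for images of products of orbits -/

/-- Applying one permutation to all coordinates of `x` stays in the product of orbits, so the image
contains the whole orbit of `F` along `x`. -/
lemma le_log_card_boxImage_permOrbit {T : Type*} {n m : ℕ} (hm : 0 < m) (S : Finset (Fin n))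
    (F : (S → T) → T) (D : Finset T) (x : Fin m → Fin n → D) :
    m * pushEntropy (fun ω : Fin n → D => F fun s => (ω s : T)) (emp x) -
        (univ.image fun ω : Fin n → D => F fun s => (ω s : T)).card * (1 + Real.log (m + 1)) ≤
      Real.log (boxImage S (coordExt m F) fun s => permOrbit fun r => (x r s : T)).card := by
  rw [pushEntropy_emp]
  refine (le_log_card_permOrbit hm _ _ fun r => ?_).trans ?_
  · exact Finset.mem_image_of_mem _ (Finset.mem_univ (x r))
  refine Real.log_le_log (by exact_mod_cast (permOrbit_nonempty _).card_pos) ?_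
  refine Nat.cast_le.2 (Finset.card_le_card fun z hz => ?_)
  obtain ⟨σ, rfl⟩ := mem_permOrbit.1 hz
  exact mem_boxImage.2 ⟨fun s r => x (σ r) s, fun s => mem_permOrbit.2 ⟨σ, rfl⟩, rfl⟩

/-- A point of the image arises by permuting each coordinate of `x` separately, which preserves the
one-coordinate marginals. Choose `v` over a point whose orbit is largest; the number of types costs
`U.card * log (m + 1)`, and Stirling one further term. -/
lemma exists_log_card_boxImage_permOrbit_le {T : Type*} {n m : ℕ} (hm : 0 < m)
    (S : Finset (Fin n)) (F : (S → T) → T) (D : Finset T) (x : Fin m → Fin n → D) :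
    ∃ v : Fin m → S → D,
      (∀ (s : S) (t : T), push (fun ω : S → D => (ω s : T)) (emp v) t =
        push (fun ω : Fin n → D => (ω s : T)) (emp x) t) ∧
      Real.log (boxImage S (coordExt m F) fun s => permOrbit fun r => (x r s : T)).card ≤
        m * pushEntropy (fun ω : S → D => F fun s => (ω s : T)) (emp v) +
          ((univ.image fun ω : S → D => F fun s => (ω s : T)).card + 1) *
            (1 + Real.log (m + 1)) := by
  set U := univ.image fun ω : S → D => F fun s => (ω s : T)
  have hlift : ∀ z ∈ boxImage S (coordExt m F) fun s => permOrbit fun r => (x r s : T),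
      ∃ σ : S → Equiv.Perm (Fin m), (fun r => F fun s => (x (σ s r) s : T)) = z := by
    intro z hz
    obtain ⟨t, ht, rfl⟩ := mem_boxImage.1 hz
    choose σ hσ using fun s => mem_permOrbit.1 (ht s)
    refine ⟨σ, funext fun r => congrArg F (funext fun s => congrFun (hσ s) r)⟩
  obtain ⟨z, hz, hcard⟩ := exists_card_le_permOrbit U
    (boxImage S (coordExt m F) fun s => permOrbit fun r => (x r s : T))
    (boxImage_nonempty _ _ fun s => permOrbit_nonempty _) (by
      intro z hz r
      obtain ⟨σ, rfl⟩ := hlift z hz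
      exact Finset.mem_image.2 ⟨fun s => x (σ s r) s, Finset.mem_univ _, rfl⟩)
  obtain ⟨σ, rfl⟩ := hlift z hz
  refine ⟨fun r s => x (σ s r) s, fun s t => ?_, ?_⟩
  · rw [push_emp, push_emp, emp, emp,
      ← occ_comp_perm ((fun ω : Fin n → D => (ω s : T)) ∘ x) (σ s) t]
    rfl
  · rw [pushEntropy_emp]
    have h1 := log_card_permOrbit_le hm (fun r => F fun s => (x (σ s r) s : T)) U fun r =>
      Finset.mem_image.2 ⟨fun s => x (σ s r) s, Finset.mem_univ _, rfl⟩
    have h2 : Real.log (boxImage S (coordExt m F) fun s => permOrbit fun r => (x r s : T)).card ≤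
        U.card * Real.log (m + 1) +
          Real.log (permOrbit fun r => F fun s => (x (σ s r) s : T)).card := by
      rw [← Real.log_pow, ← Real.log_mul (by positivity)
        (by simpa using (permOrbit_nonempty _).ne_empty)]
      refine Real.log_le_log ?_ (by exact_mod_cast hcard)
      exact_mod_cast (boxImage_nonempty _ _ fun s => permOrbit_nonempty _).card_pos
    have h3 : (0 : ℝ) ≤ U.card := Nat.cast_nonneg _
    refine h2.trans ((add_le_add_right h1 _).trans ?_)
    change _ ≤ m * empEntropy (fun r => F fun s => (x (σ s r) s : T)) U + _
    nlinarith

lemma exists_emp_pushEntropy_le {T : Type*} {n k l m : ℕ} (hm : 0 < m)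
    (S : Fin k → Finset (Fin n)) (R : Fin l → Finset (Fin n))
    (F : ∀ i, (S i → T) → T) (G : ∀ j, (R j → T) → T)
    (α : Fin k → ℝ) (β : Fin l → ℝ) (hα : ∀ i, 0 ≤ α i) (hβ : ∀ j, 0 ≤ β j)
    (h : ∀ A : Fin n → Finset (Fin m → T), (∀ s, (A s).Nonempty) →
      ∏ i, ((boxImage (S i) (coordExt m (F i)) A).card : ℝ) ^ α i ≤
        ∏ j, ((boxImage (R j) (coordExt m (G j)) A).card : ℝ) ^ β j)
    (D : Finset T) (x : Fin m → Fin n → D) :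
    ∃ v : ∀ j, Fin m → R j → D,
      (∀ (j) (s : R j) (t : T), push (fun ω : R j → D => (ω s : T)) (emp (v j)) t =
        push (fun ω : Fin n → D => (ω s : T)) (emp x) t) ∧
      ∑ i, α i * pushEntropy (fun ω : Fin n → D => F i fun s => (ω s : T)) (emp x) ≤
        ∑ j, β j * pushEntropy (fun ω : R j → D => G j fun s => (ω s : T)) (emp (v j)) +
        (∑ i, α i * (univ.image fun ω : Fin n → D => F i fun s => (ω s : T)).card +
          ∑ j, β j * ((univ.image fun ω : R j → D => G j fun s => (ω s : T)).card + 1)) *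
            ((1 + Real.log (m + 1)) / m) := by
  choose v hv hvle using fun j => exists_log_card_boxImage_permOrbit_le hm (R j) (G j) D x
  refine ⟨v, hv, ?_⟩
  -- The hypothesis is used only for these boxes of rearrangements.
  have h' := h (fun s => permOrbit fun r => (x r s : T)) fun s => permOrbit_nonempty _
  rw [prod_rpow_le_iff_sum_log_le _ _
    (fun i => (boxImage_nonempty _ _ fun s => permOrbit_nonempty _).card_pos)
    (fun j => (boxImage_nonempty _ _ fun s => permOrbit_nonempty _).card_pos)] at h'
  have hl := Finset.sum_le_sum fun i (_ : i ∈ univ) => mul_le_mul_of_nonneg_left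
    (le_log_card_boxImage_permOrbit hm (S i) (F i) D x) (hα i)
  have hr := Finset.sum_le_sum fun j (_ : j ∈ univ) => mul_le_mul_of_nonneg_left
    (hvle j) (hβ j)
  have hall := hl.trans (h'.trans hr)
  simp only [mul_sub, mul_add, Finset.sum_add_distrib, Finset.sum_sub_distrib,
    mul_left_comm _ (m : ℝ), ← mul_assoc, ← Finset.sum_mul] at hall
  have hm0 : (0 : ℝ) < m := by exact_mod_cast hm
  rw [← sub_nonneg] at hall ⊢
  refine (div_nonneg hall hm0.le).trans_eq ?_
  simp only [mul_add, Finset.sum_add_distrib, mul_assoc, mul_one, ← Finset.mul_sum]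
  field_simp
  ring

/-! ### Passage to the limit -/

lemma tendsto_one_add_log_div :
    Tendsto (fun m : ℕ => (1 + Real.log ((m : ℝ) + 1)) / m) atTop (𝓝 0) := by
  have h1 : Tendsto (fun m : ℕ => Real.log ((m : ℝ) + 1) / ((m : ℝ) + 1)) atTop (𝓝 0) := by
    have := Real.isLittleO_log_id_atTop.tendsto_div_nhds_zero
    exact this.comp (tendsto_natCast_atTop_atTop.atTop_add tendsto_const_nhds)
  have h2 : Tendsto (fun m : ℕ => 1 + 1 / (m : ℝ)) atTop (𝓝 (1 + 0)) :=
    tendsto_one_div_atTop_nhds_zero_nat.const_add 1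
  have h3 := tendsto_one_div_atTop_nhds_zero_nat.add (h1.mul h2)
  simp only [zero_mul, add_zero] at h3
  refine h3.congr' ?_
  filter_upwards [eventually_gt_atTop 0] with m hm
  have hm0 : (0 : ℝ) < m := by exact_mod_cast hm
  field_simp

lemma exists_weights_pushEntropy_le {T : Type*} {n k l : ℕ}
    (S : Fin k → Finset (Fin n)) (R : Fin l → Finset (Fin n))
    (F : ∀ i, (S i → T) → T) (G : ∀ j, (R j → T) → T)
    (α : Fin k → ℝ) (β : Fin l → ℝ) (hα : ∀ i, 0 ≤ α i) (hβ : ∀ j, 0 ≤ β j)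
    (h : ∀ (m : ℕ) (A : Fin n → Finset (Fin m → T)), (∀ s, (A s).Nonempty) →
      ∏ i, ((boxImage (S i) (coordExt m (F i)) A).card : ℝ) ^ α i ≤
        ∏ j, ((boxImage (R j) (coordExt m (G j)) A).card : ℝ) ^ β j)
    (D : Finset T) (q : (Fin n → D) → ℝ) (hq : q ∈ stdSimplex ℝ (Fin n → D)) :
    ∃ w : ∀ j, (R j → D) → ℝ, (∀ j, w j ∈ stdSimplex ℝ (R j → D)) ∧
      (∀ (j) (s : R j) (t : T), push (fun ω : R j → D => (ω s : T)) (w j) t =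
        push (fun ω : Fin n → D => (ω s : T)) q t) ∧
      ∑ i, α i * pushEntropy (fun ω : Fin n → D => F i fun s => (ω s : T)) q ≤
        ∑ j, β j * pushEntropy (fun ω : R j → D => G j fun s => (ω s : T)) (w j) := by
  obtain ⟨x, hx⟩ := exists_emp_tendsto hq
  -- Length `m + 1` keeps the empirical distributions normalised.
  choose v hv hvle using fun m : ℕ =>
    exists_emp_pushEntropy_le m.succ_pos S R F G α β hα hβ (h (m + 1)) D (x (m + 1))
  -- Compactness of the product of simplices gives one subsequence that works for all `j`.
  obtain ⟨w, hw, φ, hφ, hlim⟩ := (isCompact_univ_pi fun j =>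
    isCompact_stdSimplex ℝ (R j → D)).tendsto_subseq (x := fun m j => emp (v m j))
      fun m j _ => emp_mem m.succ_pos _
  have hsucc : Tendsto (fun m => φ m + 1) atTop atTop :=
    (tendsto_add_atTop_nat 1).comp hφ.tendsto_atTop
  have hxφ := hx.comp hsucc
  have hwj := fun j => tendsto_pi_nhds.1 hlim j
  refine ⟨w, fun j => hw j (Set.mem_univ j), fun j s t => ?_, ?_⟩
  · refine tendsto_nhds_unique (((continuous_push _ t).tendsto _).comp (hwj j)) ?_
    refine (((continuous_push _ t).tendsto _).comp hxφ).congr fun m => ?_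
    exact (hv (φ m) j s t).symm
  · have hl := tendsto_finsetSum univ fun i _ =>
      (((continuous_pushEntropy fun ω : Fin n → D => F i fun s => (ω s : T)).tendsto _).comp
        hxφ).const_mul (α i)
    have hr := (tendsto_finsetSum univ fun j _ =>
      (((continuous_pushEntropy fun ω : R j → D => G j fun s => (ω s : T)).tendsto _).comp
        (hwj j)).const_mul (β j)).add ((tendsto_one_add_log_div.comp hsucc).const_mul
          (∑ i, α i * (univ.image fun ω : Fin n → D => F i fun s => (ω s : T)).card +
          ∑ j, β j * ((univ.image fun ω : R j → D => G j fun s => (ω s : T)).card + 1)))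
    rw [mul_zero, add_zero] at hr
    exact le_of_tendsto_of_tendsto' hl hr fun m => hvle (φ m)

lemma maxEntropy_le_of_card_boxImage_le {T : Type*} [AddCommGroup T]
    {n k l : ℕ} (f : Fin k → Fin n → ℤ) (g : Fin l → Fin n → ℤ)
    (α : Fin k → ℝ) (β : Fin l → ℝ) (hα : ∀ i, 0 ≤ α i) (hβ : ∀ j, 0 ≤ β j)
    (hf : Pairwise fun i i' => Disjoint (supp (f i)) (supp (f i')))
    (h : ∀ (m : ℕ) (A : Fin n → Finset (Fin m → T)), (∀ s, (A s).Nonempty) →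
      ∏ i, ((boxImage (supp (f i)) (coordExt m (form (f i))) A).card : ℝ) ^ α i ≤
        ∏ j, ((boxImage (supp (g j)) (coordExt m (form (g j))) A).card : ℝ) ^ β j)
    (P : Fin n → PMF T) (hP : ∀ s, (P s).support.Finite) :
    ∑ i, α i * maxEntropy (f i) P ≤ ∑ j, β j * maxEntropy (g j) P := by
  obtain ⟨D, hD⟩ := exists_finset_support P hP
  choose q hq hqe using fun i => (isGreatest_maxEntropy (f i) P hP).1
  obtain ⟨q₀, hq₀⟩ := exists_coupling P
  -- A single coupling of all the `P s` that is optimal for every `f i` at once.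
  obtain ⟨p, hpq, hpP⟩ := exists_joint (fun i => supp (f i)) hf (fun s => {P s}) q₀ hq₀ q
    fun i s => hq i s
  obtain ⟨p, rfl⟩ := exists_map_val_eq D p fun s t ht => hD s t (hpP s ▸ ht)
  obtain ⟨w, hw, hwm, hle⟩ := exists_weights_pushEntropy_le (fun i => supp (f i))
    (fun j => supp (g j)) (fun i => form (f i)) (fun j => form (g j)) α β hα hβ h D
    (weight p) (weight_mem p)
  refine le_trans (le_of_eq (Finset.sum_congr rfl fun i _ => ?_)) (hle.trans
    (Finset.sum_le_sum fun j _ => mul_le_mul_of_nonneg_left ?_ (hβ j)))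
  · rw [← hqe i, ← hpq i, ← entropy_map]
    simp only [PMF.map_comp]
    rfl
  · refine (isGreatest_maxEntropy (g j) P hP).2 ?_
    rw [couplingEntropies_eq (g j) P D hD]
    refine ⟨w j, ⟨hw j, fun s t => ?_⟩, rfl⟩
    rw [hwm j s t, ← toReal_map_apply, ← Set.mem_singleton_iff.1 (hpP s), PMF.map_comp]
    rfl

end

end SumsetEntropy

theorem theorem1 {T : Type*} [AddCommGroup T] [AddGroup.FG T] [IsAddTorsionFree T]
    {n k l : ℕ} (f : Fin k → Fin n → ℤ) (g : Fin l → Fin n → ℤ)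
    (α : Fin k → ℝ) (β : Fin l → ℝ) (hα : ∀ i, 0 < α i) (hβ : ∀ j, 0 < β j)
    (hf : Pairwise fun i i' =>
      Disjoint (SumsetEntropy.supp (f i)) (SumsetEntropy.supp (f i'))) :
    -- the maxima over couplings exist
    (∀ (c : Fin n → ℤ) (P : Fin n → PMF T), (∀ s, (P s).support.Finite) →
      IsGreatest (SumsetEntropy.couplingEntropies c P) (SumsetEntropy.maxEntropy c P)) ∧
    List.TFAE [
      -- (a)
      ∀ A : Fin n → Finset T, (∀ s, (A s).Nonempty) →
        ∏ i, ((SumsetEntropy.boxImage (SumsetEntropy.supp (f i))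
            (SumsetEntropy.form (f i)) A).card : ℝ) ^ α i ≤
          ∏ j, ((SumsetEntropy.boxImage (SumsetEntropy.supp (g j))
            (SumsetEntropy.form (g j)) A).card : ℝ) ^ β j,
      -- (b)
      ∀ (m : ℕ) (A : Fin n → Finset (Fin m → T)), (∀ s, (A s).Nonempty) →
        ∏ i, ((SumsetEntropy.boxImage (SumsetEntropy.supp (f i))
            (SumsetEntropy.coordExt m (SumsetEntropy.form (f i))) A).card : ℝ) ^ α i ≤
          ∏ j, ((SumsetEntropy.boxImage (SumsetEntropy.supp (g j))
            (SumsetEntropy.coordExt m (SumsetEntropy.form (g j))) A).card : ℝ) ^ β j,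
      -- (c)
      ∀ P : Fin n → PMF T, (∀ s, (P s).support.Finite) →
        ∑ i, α i * SumsetEntropy.maxEntropy (f i) P ≤
          ∑ j, β j * SumsetEntropy.maxEntropy (g j) P] := by
  refine ⟨fun c P hP => SumsetEntropy.isGreatest_maxEntropy c P hP, ?_⟩
  have hα' : ∀ i, 0 ≤ α i := fun i => (hα i).le
  have hβ' : ∀ j, 0 ≤ β j := fun j => (hβ j).le
  tfae_have 1 → 2 := SumsetEntropy.card_boxImage_hom_le f g α β hβ'
  tfae_have 2 → 3 := SumsetEntropy.maxEntropy_le_of_card_boxImage_le f g α β hα' hβ' hf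
  tfae_have 3 → 1 := SumsetEntropy.card_boxImage_le_of_maxEntropy_le f g α β hα' hβ' hf
  tfae_finish
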